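/- Let $\mathbb N_0=\{0,1,2,\dots\}$. For $S\subseteq\mathbb N_0$ let $$X_S=\{x\in\{0,1\}^{\mathbb N_0}:\ \text{the number of $0$'s between any two consecutive $1$'s of $x$ belongs to } S\}$$ be the $S$-gap shift, and let $\mathcal L(X_S)$ be its language, i.e. the set of all finite words $x_0x_1\cdots x_{n-1}$ with $n\ge 0$ and $x\in X_S$. For an integer $g\ge 2$ put $$A_S=\{w_0+w_1g+\cdots+w_{n-1}g^{n-1}:\ w_0w_1\cdots w_{n-1}\in\mathcal L(X_S)\}\subseteq\mathbb N_0 .$$ For $A\subseteq\mathbb N_0$ the lower and upper mass dimensions are the $\liminf$ and the $\limsup$, as $N\to\infty$, of $\log|A\cap[0,N)|/\log N$ (with the convention that both are $0$ if $A=\emptyset$); if they are equal, the common value is the mass dimension $\dim_{\mathrm M}(A)$, and one says that it exists. **Proposition.** Let $g\ge 2$ be an integer and let $S\subseteq\mathbb N_0$. Then $\dim_{\mathrm M}(A_S)$ exists, and for every infinite arithmetic progression $P=\{ak+b:\ k\in\mathbb N_0\}$ with integers $a\ge 1$ and $b\ge 0$, the mass dimension $\dim_{\mathrm M}(A_S\cap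 P)$ exists and is either $0$ or $\dim_{\mathrm M}(A_S)$. Moreover, this includes non-sofic cases: if $S$ is the set of prime numbers, then $X_S$ is a subshift (a closed subset of $\{0,1\}^{\mathbb N_0}$ that is mapped into itself by the left shift) which is not sofic, i.e. it is not the set of label sequences of the infinite paths of any labelled directed multigraph with finitely many nodes. -/

import Mathlib

open Filter Topology

namespace GapShift

/-! ### Symbolic dynamics on one-sided sequences -/

/-- The left shift on one-sided sequences. -/
def shift {D : Type} (x : ℕ → D) : ℕ → D := fun n => x (n + 1)

/-- A subshift: a closed, shift-invariant set of one-sided sequences (product topology). -/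
def IsSubshift {D : Type} [TopologicalSpace D] (X : Set (ℕ → D)) : Prop :=
  IsClosed X ∧ Set.MapsTo shift X X

/-- The language of `X`: all finite words `x 0, …, x (n - 1)` with `x ∈ X` and `n ≥ 0`. -/
def language {D : Type} (X : Set (ℕ → D)) : Set (List D) :=
  {w | ∃ x ∈ X, ∃ n : ℕ, w = (List.range n).map x}

/-- A labelled directed multigraph with node set `V` and labels in `D`. -/
structure LabelledGraph (V D : Type) where
  /-- the edges; parallel edges and loops are allowed -/
  Edge : Type
  /-- starting node -/
  src : Edge → V
  /-- terminal node -/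
  tgt : Edge → V
  /-- label -/
  label : Edge → D

/-- The set of label sequences of infinite paths of a labelled graph. -/
def LabelledGraph.shiftSpace {V D : Type} (G : LabelledGraph V D) : Set (ℕ → D) :=
  {x | ∃ e : ℕ → G.Edge, (∀ j, G.src (e (j + 1)) = G.tgt (e j)) ∧ ∀ j, x j = G.label (e j)}

/-- Sofic: read off from a labelled directed multigraph with finitely many nodes. -/
def IsSofic {D : Type} (X : Set (ℕ → D)) : Prop :=
  ∃ (V : Type) (_ : Finite V) (G : LabelledGraph V D), X = G.shiftSpace

/-- The `S`-gap shift: the 0-1 sequences in which the number `n` of `0`s between any two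
consecutive `1`s (here at positions `i` and `i + n + 1`) belongs to `S`. -/
def sGapShift (S : Set ℕ) : Set (ℕ → Fin 2) :=
  {x | ∀ i n : ℕ, x i = 1 → x (i + n + 1) = 1 → (∀ k < n, x (i + 1 + k) = 0) → n ∈ S}

/-! ### Sets of integers -/

/-- `(w)_g = w₀ + w₁ g + ⋯ + w_{n-1} g ^ (n-1)`, the first letter being the least significant. -/
def wordValue (g : ℕ) {k : ℕ} (w : List (Fin k)) : ℕ :=
  Nat.ofDigits g (w.map Fin.val)

/-- The `g`-language set of a set of sequences of digits `0, …, k - 1` (used with `k ≤ g`). -/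
def languageSet (g : ℕ) {k : ℕ} (X : Set (ℕ → Fin k)) : Set ℕ :=
  {m | ∃ w ∈ language X, m = wordValue g w}

/-- The infinite arithmetic progression `b, b + a, b + 2 a, …`. -/
def arithProg (a b : ℕ) : Set ℕ := {n | ∃ k : ℕ, n = a * k + b}

/-- `log |A ∩ [0, N)| / log N`. -/
noncomputable def massRatio (A : Set ℕ) (N : ℕ) : ℝ :=
  Real.log ((A ∩ Set.Iio N).ncard : ℝ) / Real.log (N : ℝ)

/-- The mass ratio takes values in `[0, 1]`, so that its lower and upper limits as real numbers
are the usual ones; for the empty set it is constantly `0`. -/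
theorem massRatio_mem_Icc (A : Set ℕ) (N : ℕ) : massRatio A N ∈ Set.Icc (0 : ℝ) 1 := by
  have hc : (A ∩ Set.Iio N).ncard ≤ N := by
    have h := Set.ncard_le_ncard (Set.inter_subset_right : A ∩ Set.Iio N ⊆ Set.Iio N)
      (Set.finite_Iio N)
    simpa [Set.ncard_eq_toFinset_card'] using h
  refine ⟨div_nonneg (Real.log_natCast_nonneg _) (Real.log_natCast_nonneg _), ?_⟩
  refine div_le_one_of_le₀ ?_ (Real.log_natCast_nonneg _)
  rcases Nat.eq_zero_or_pos (A ∩ Set.Iio N).ncard with h | h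
  · simp [h, Real.log_natCast_nonneg]
  · exact Real.log_le_log (by exact_mod_cast h) (by exact_mod_cast hc)

/-- Lower mass dimension. -/
noncomputable def lowerMassDim (A : Set ℕ) : ℝ := liminf (massRatio A) atTop

/-- Upper mass dimension. -/
noncomputable def upperMassDim (A : Set ℕ) : ℝ := limsup (massRatio A) atTop

/-- The mass dimension of `A` exists and equals `d`. -/
def HasMassDim (A : Set ℕ) (d : ℝ) : Prop := lowerMassDim A = d ∧ upperMassDim A = d

end GapShift

namespace GapShift

/-! Up to leading zeros, a nonzero element of A_S has the digits 0^k 1 0^{s₁} 1 ⋯ 0^{sᵣ} 1, least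
significant first, with all sᵢ in S; conversely every k and every list of gaps occur
(`eq_zero_or_of_mem_languageSet`, `pow_mul_mem_languageSet`). Cutting digit strings in two makes the
counts below g^n submultiplicative, so Fekete's lemma gives the dimension of A_S.

If A_S ∩ P is finite, its dimension is 0. Otherwise write a = a₁a₂ with a₁ dividing a power of g and
a₂ coprime to g, and fix a large element of A_S ∩ P. Appending gaps to it adds a multiple of a high
power of g, hence of a₁. Modulo a₂ gaps act as permutations of a finite set, so every list has a
completion of bounded length that makes the added value vanish modulo a₂. Thus lists of gaps embed
into A_S ∩ P up to a bounded factor and a bounded lengthening (`exists_gapCount_le`), while A_S has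
at most n + 1 times as many elements below g^n as there are such lists (`powCount_le_mul_gapCount`).
Neither loss changes the exponential growth rate.

Non-soficity for the primes comes from pumping the block of zeros in 1 0^p 1 0 0 ⋯. -/

/-! ### Subshift property and non-soficity -/

theorem isClosed_sGapShift (S : Set ℕ) : IsClosed (sGapShift S) := by
  have h : sGapShift S = ⋂ (i : ℕ) (n : ℕ), {x : ℕ → Fin 2 |
      x i = 1 → x (i + n + 1) = 1 → (∀ k < n, x (i + 1 + k) = 0) → n ∈ S} := by
    ext x; simp [sGapShift]
  rw [h]
  refine isClosed_iInter fun i => isClosed_iInter fun n => ?_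
  have hc : ∀ (j : ℕ) (d : Fin 2), IsClopen {x : ℕ → Fin 2 | x j = d} := fun j d =>
    (isClopen_discrete {d}).preimage (continuous_apply j)
  have h3 : IsOpen {x : ℕ → Fin 2 | ∀ k < n, x (i + 1 + k) = 0} := by
    have : {x : ℕ → Fin 2 | ∀ k < n, x (i + 1 + k) = 0} =
        ⋂ k ∈ Set.Iio n, {x : ℕ → Fin 2 | x (i + 1 + k) = 0} := by
      ext x; simp
    rw [this]
    exact (Set.finite_Iio n).isOpen_biInter fun k _ => (hc _ _).isOpen
  exact isClosed_imp (hc _ _).isOpen (isClosed_imp (hc _ _).isOpen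
    (isClosed_imp h3 isClosed_const))

theorem shift_mem_sGapShift {S : Set ℕ} {x : ℕ → Fin 2} (hx : x ∈ sGapShift S) :
    shift x ∈ sGapShift S := by
  intro i n h1 h2 h3
  refine hx (i + 1) n h1 ?_ fun k hk => ?_
  · have := h2
    simp only [shift] at this
    convert this using 2; omega
  · have := h3 k hk
    simp only [shift] at this
    convert this using 2; omega

theorem isSubshift_sGapShift (S : Set ℕ) : IsSubshift (sGapShift S) :=
  ⟨isClosed_sGapShift S, fun _ hx => shift_mem_sGapShift hx⟩

/-- The sequence `1 0ⁿ 1 0 0 0 …`. -/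
def twoOnes (n : ℕ) : ℕ → Fin 2 := fun m => if m = 0 ∨ m = n + 1 then 1 else 0

theorem twoOnes_mem_iff {S : Set ℕ} {n : ℕ} : twoOnes n ∈ sGapShift S ↔ n ∈ S := by
  constructor
  · intro h
    refine h 0 n (by simp [twoOnes]) (by simp [twoOnes]) fun k hk => ?_
    simp only [twoOnes]
    rw [if_neg (by omega)]
  · intro h i m h1 h2 _
    simp only [twoOnes] at h1 h2
    split_ifs at h1 h2 with h3 h4 <;> simp_all
    obtain rfl : m = n := by omega
    exact h

/-- A sofic `S`-gap shift has an `S` that contains an infinite arithmetic progression through each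
of its large elements. -/
theorem exists_progression_of_isSofic {S : Set ℕ} (h : IsSofic (sGapShift S)) :
    ∃ N : ℕ, ∀ p ∈ S, N ≤ p → ∃ r, 0 < r ∧ ∀ k, p + k * r ∈ S := by
  obtain ⟨V, hV, G, hG⟩ := h
  refine ⟨Nat.card V, fun p hp hle => ?_⟩
  have hmem := twoOnes_mem_iff.2 hp
  rw [hG] at hmem
  obtain ⟨e, he, hlab⟩ := hmem
  have : Fintype V := Fintype.ofFinite V
  -- The edges 1, …, p + 1 start at p + 1 > |V| nodes, and the edges between two of these starts all
  -- carry the label 0.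
  obtain ⟨i, i', hne, heq⟩ := Fintype.exists_ne_map_eq_of_card_lt
    (fun i : Fin (p + 1) => G.src (e (i + 1))) (by
      rw [Fintype.card_fin, ← Nat.card_eq_fintype_card]; omega)
  wlog hlt : i < i' generalizing i i'
  · exact this i' i hne.symm heq.symm (lt_of_le_of_ne (not_lt.1 hlt) hne.symm)
  have hlt' : (i : ℕ) < i' := hlt
  have hi' := i'.2
  refine ⟨i' - i, by omega, fun k => ?_⟩
  -- The coinciding nodes are kept in the induction so that the same loop can be inserted again.
  suffices H : ∃ e : ℕ → G.Edge, (∀ j, G.src (e (j + 1)) = G.tgt (e j)) ∧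
      (∀ j, twoOnes (p + k * (i' - i)) j = G.label (e j)) ∧
      G.src (e (i + 1)) = G.src (e (i' + 1)) by
    obtain ⟨e, h1, h2, -⟩ := H
    rw [← twoOnes_mem_iff, hG]
    exact ⟨e, h1, h2⟩
  induction k with
  | zero => exact ⟨e, he, by simpa using hlab, heq⟩
  | succ k ih =>
    obtain ⟨f, h1, h2, h3⟩ := ih
    have hidx : ∀ j, ¬ j < (i' : ℕ) + 1 → j + 1 - (i' - i) = (j - (i' - i)) + 1 := by omega
    refine ⟨fun j => if j < i' + 1 then f j else f (j - (i' - i)), fun j => ?_, fun j => ?_, ?_⟩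
    · rcases lt_trichotomy j i' with hj | rfl | hj
      · simp [hj, Nat.lt_succ_of_lt hj, h1]
      · have : (i' : ℕ) + 1 - (i' - i) = i + 1 := by omega
        simp [this, h3, h1]
      · dsimp only
        rw [if_neg (by omega), if_neg (by omega), hidx j (by omega), h1]
    · have hmul : (k + 1) * ((i' : ℕ) - i) = k * (i' - i) + (i' - i) := by ring
      rw [hmul]
      dsimp only
      split_ifs with hj
      · rw [← h2]
        simp only [twoOnes]
        congr 1
        apply propext
        omega
      · rw [← h2]
        simp only [twoOnes]
        congr 1
        apply propext
        omega
    · have : (i' : ℕ) + 1 - (i' - i) = i + 1 := by omega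
      simp [this, hlt']

theorem not_isSofic_sGapShift_primes : ¬ IsSofic (sGapShift {p : ℕ | p.Prime}) := by
  intro h
  obtain ⟨N, hN⟩ := exists_progression_of_isSofic h
  obtain ⟨p, hle, hp⟩ := Nat.exists_infinite_primes N
  obtain ⟨r, hr, hS⟩ := hN p hp hle
  -- Taking k = p gives the composite number p(1 + r).
  have h1 : (p + p * r).Prime := hS p
  rw [← mul_one_add] at h1
  exact Nat.not_prime_mul hp.one_lt.ne' (by omega) h1

/-! ### Digit words, and cutting them by division and remainder -/

/-- The number with base `g` digits `x 0, …, x (n - 1)`. -/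
def prefixValue (g : ℕ) (x : ℕ → Fin 2) : ℕ → ℕ
  | 0 => 0
  | n + 1 => x 0 + g * prefixValue g (shift x) n

theorem prefixValue_eq_wordValue (g : ℕ) (x : ℕ → Fin 2) (n : ℕ) :
    prefixValue g x n = wordValue g ((List.range n).map x) := by
  induction n generalizing x with
  | zero => simp [prefixValue, wordValue]
  | succ n ih =>
    rw [prefixValue, ih, List.range_succ_eq_map, List.map_cons, List.map_map, wordValue,
      wordValue, List.map_cons, Nat.ofDigits_cons]
    rfl

theorem mem_languageSet_iff {g : ℕ} {X : Set (ℕ → Fin 2)} {m : ℕ} :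
    m ∈ languageSet g X ↔ ∃ x ∈ X, ∃ n, m = prefixValue g x n := by
  constructor
  · rintro ⟨w, ⟨x, hx, n, rfl⟩, rfl⟩
    exact ⟨x, hx, n, (prefixValue_eq_wordValue ..).symm⟩
  · rintro ⟨x, hx, n, rfl⟩
    exact ⟨_, ⟨x, hx, n, rfl⟩, prefixValue_eq_wordValue ..⟩

theorem div_mem_languageSet {g : ℕ} (hg : 2 ≤ g) {S : Set ℕ} {m : ℕ}
    (hm : m ∈ languageSet g (sGapShift S)) : m / g ∈ languageSet g (sGapShift S) := by
  obtain ⟨x, hx, n, rfl⟩ := mem_languageSet_iff.1 hm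
  refine mem_languageSet_iff.2 ⟨shift x, shift_mem_sGapShift hx, n - 1, ?_⟩
  cases n with
  | zero => simp [prefixValue]
  | succ n =>
    have : (x 0 : ℕ) < g := by omega
    rw [prefixValue, Nat.add_mul_div_left _ _ (by omega), Nat.div_eq_of_lt this]
    simp

theorem div_pow_mem_languageSet {g : ℕ} (hg : 2 ≤ g) {S : Set ℕ} {m : ℕ}
    (hm : m ∈ languageSet g (sGapShift S)) (k : ℕ) :
    m / g ^ k ∈ languageSet g (sGapShift S) := by
  induction k with
  | zero => simpa
  | succ k ih => rw [pow_succ, ← Nat.div_div_eq_div_mul]; exact div_mem_languageSet hg ih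

theorem prefixValue_mod {g : ℕ} (hg : 2 ≤ g) (x : ℕ → Fin 2) (n k : ℕ) :
    prefixValue g x n % g ^ k = prefixValue g x (min n k) := by
  induction n generalizing x k with
  | zero => simp [prefixValue]
  | succ n ih =>
    cases k with
    | zero => simp [prefixValue, Nat.mod_one]
    | succ k =>
      rw [Nat.succ_min_succ, prefixValue, prefixValue, ← ih, pow_succ', Nat.mod_mul,
        Nat.add_mul_mod_self_left, Nat.add_mul_div_left _ _ (by omega),
        Nat.mod_eq_of_lt (by omega), Nat.div_eq_of_lt (by omega), zero_add]

theorem mod_pow_mem_languageSet {g : ℕ} (hg : 2 ≤ g) {X : Set (ℕ → Fin 2)} {m : ℕ}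
    (hm : m ∈ languageSet g X) (k : ℕ) : m % g ^ k ∈ languageSet g X := by
  obtain ⟨x, hx, n, rfl⟩ := mem_languageSet_iff.1 hm
  exact mem_languageSet_iff.2 ⟨x, hx, _, prefixValue_mod hg x n k⟩

/-! ### Encoding elements by lists of gaps -/

/-- The length `(s₁ + 1) + ⋯ + (sₖ + 1)` of the word `0^{s₁} 1 ⋯ 0^{sₖ} 1`. -/
def gapLength {S : Set ℕ} (l : List S) : ℕ := (l.map fun s => (s : ℕ) + 1).sum

/-- The number such that `1 + gapValue g [s₁, …, sₖ]` has the base `g` digits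
`1 0^{s₁} 1 ⋯ 0^{sₖ} 1`. -/
def gapValue (g : ℕ) {S : Set ℕ} : List S → ℕ
  | [] => 0
  | s :: l => g ^ ((s : ℕ) + 1) * (1 + gapValue g l)

@[simp] theorem gapLength_nil {S : Set ℕ} : gapLength ([] : List S) = 0 := rfl

@[simp] theorem gapLength_cons {S : Set ℕ} (s : S) (l : List S) :
    gapLength (s :: l) = s + 1 + gapLength l := by simp [gapLength]

theorem gapLength_append {S : Set ℕ} (l l' : List S) :
    gapLength (l ++ l') = gapLength l + gapLength l' := by simp [gapLength]

theorem gapValue_append (g : ℕ) {S : Set ℕ} (l l' : List S) :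
    gapValue g (l ++ l') = gapValue g l + g ^ gapLength l * gapValue g l' := by
  induction l with
  | nil => simp [gapValue]
  | cons s l ih => rw [List.cons_append, gapValue, gapValue, ih, gapLength_cons, pow_add]; ring

theorem one_add_gapValue_lt {g : ℕ} (hg : 2 ≤ g) {S : Set ℕ} (l : List S) :
    1 + gapValue g l < g ^ (gapLength l + 1) := by
  induction l with
  | nil => simp [gapValue]; omega
  | cons s l ih =>
    have h1 : 1 < g ^ ((s : ℕ) + 1) := Nat.one_lt_pow (by omega) (by omega)
    rw [gapLength_cons, add_assoc _ (gapLength l), pow_add]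
    calc 1 + gapValue g (s :: l) < g ^ ((s : ℕ) + 1) + gapValue g (s :: l) := by omega
      _ = g ^ ((s : ℕ) + 1) * (1 + gapValue g l + 1) := by rw [gapValue]; ring
      _ ≤ _ := Nat.mul_le_mul_left _ ih

theorem dvd_gapValue (g : ℕ) {S : Set ℕ} (l : List S) : g ∣ gapValue g l := by
  cases l with
  | nil => simp [gapValue]
  | cons s l => exact Dvd.dvd.mul_right (dvd_pow_self g (by omega)) _

theorem pow_mul_left_inj_of_not_dvd {g m n : ℕ} (hg : 2 ≤ g) (hm : ¬ g ∣ m) (hn : ¬ g ∣ n) {i j : ℕ}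
    (h : g ^ i * m = g ^ j * n) : i = j ∧ m = n := by
  wlog hij : i ≤ j generalizing i j m n
  · exact (this hn hm h.symm (by omega)).imp Eq.symm Eq.symm
  obtain ⟨k, rfl⟩ := Nat.exists_eq_add_of_le hij
  rw [pow_add, mul_assoc] at h
  have h' := Nat.eq_of_mul_eq_mul_left (by positivity) h
  cases k with
  | zero => simpa using h'
  | succ k => exact absurd ⟨g ^ k * n, by rw [h']; ring⟩ hm

theorem not_dvd_one_add_gapValue {g : ℕ} (hg : 2 ≤ g) {S : Set ℕ} (l : List S) :
    ¬ g ∣ 1 + gapValue g l := by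
  rw [Nat.dvd_add_left (dvd_gapValue g l)]
  intro h
  have := Nat.le_of_dvd one_pos h
  omega

theorem gapValue_injective {g : ℕ} (hg : 2 ≤ g) {S : Set ℕ} :
    Function.Injective (gapValue g : List S → ℕ) := by
  intro l l' h
  induction l generalizing l' with
  | nil =>
    cases l' with
    | nil => rfl
    | cons s l' =>
      rw [gapValue, gapValue] at h
      have : 0 < g ^ ((s : ℕ) + 1) * (1 + gapValue g l') := by positivity
      omega
  | cons s l ih =>
    cases l' with
    | nil =>
      rw [gapValue, gapValue] at h
      have : 0 < g ^ ((s : ℕ) + 1) * (1 + gapValue g l) := by positivity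
      omega
    | cons s' l' =>
      obtain ⟨h1, h2⟩ := pow_mul_left_inj_of_not_dvd hg (not_dvd_one_add_gapValue hg l)
        (not_dvd_one_add_gapValue hg l') h
      rw [ih (by omega : gapValue g l = gapValue g l'), Subtype.ext (by omega : (s : ℕ) = s')]

/-- Base 2 values embed these lists injectively into the numbers below 2^(n + 1). -/
theorem finite_gapLength_le (S : Set ℕ) (n : ℕ) : {l : List S | gapLength l ≤ n}.Finite := by
  refine Set.Finite.of_injOn (f := gapValue 2) (t := Set.Iio (2 ^ (n + 1))) (fun l hl => ?_)
    (gapValue_injective le_rfl).injOn (Set.finite_Iio _)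
  have h1 := one_add_gapValue_lt le_rfl l
  have h2 : 2 ^ (gapLength l + 1) ≤ 2 ^ (n + 1) :=
    Nat.pow_le_pow_right (by omega) (Nat.succ_le_succ hl)
  simp only [Set.mem_Iio]
  omega

/-- The position k of the first 1 is tracked in `x` itself because, when a 1 is prepended, k becomes
a new gap and must lie in S. -/
theorem prefixValue_eq_zero_or {g : ℕ} {S : Set ℕ} {x : ℕ → Fin 2} (hx : x ∈ sGapShift S)
    (n : ℕ) : prefixValue g x n = 0 ∨ ∃ (k : ℕ) (l : List S),
      prefixValue g x n = g ^ k * (1 + gapValue g l) ∧ x k = 1 ∧ ∀ i < k, x i = 0 := by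
  induction n generalizing x with
  | zero => exact Or.inl rfl
  | succ n ih =>
    rw [prefixValue]
    have h01 : x 0 = 0 ∨ x 0 = 1 := by omega
    rcases ih (shift_mem_sGapShift hx) with h | ⟨k, l, h1, h3, h4⟩
    · rw [h]
      rcases h01 with h0 | h0
      · exact Or.inl (by simp [h0])
      · exact Or.inr ⟨0, [], by simp [h0, gapValue], h0, by simp⟩
    · rw [h1]
      rcases h01 with h0 | h0
      · refine Or.inr ⟨k + 1, l, by simp [h0]; ring, h3, fun i hi => ?_⟩
        cases i with
        | zero => exact h0
        | succ i => exact h4 i (by omega)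
      · have hk : k ∈ S := by
          refine hx 0 k h0 (by simpa [shift] using h3) fun i hi => ?_
          have := h4 i hi
          simp only [shift] at this
          convert this using 2; omega
        refine Or.inr ⟨0, ⟨k, hk⟩ :: l, ?_, h0, by simp⟩
        simp [h0, gapValue]; ring

/-- The sequence `d x 0 x 1 …`. -/
def consSeq (d : Fin 2) (x : ℕ → Fin 2) : ℕ → Fin 2
  | 0 => d
  | n + 1 => x n

theorem consSeq_mem_sGapShift {S : Set ℕ} {x : ℕ → Fin 2} (hx : x ∈ sGapShift S) {d : Fin 2}
    (hd : d = 1 → ∀ n, x n = 1 → (∀ k < n, x k = 0) → n ∈ S) :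
    consSeq d x ∈ sGapShift S := by
  intro i n h1 h2 h3
  cases i with
  | zero =>
    rw [zero_add] at h2
    refine hd h1 n h2 fun k hk => ?_
    have := h3 k hk
    rwa [zero_add, add_comm] at this
  | succ i =>
    have e1 : i + 1 + n + 1 = (i + n + 1) + 1 := by omega
    rw [e1] at h2
    refine hx i n h1 h2 fun k hk => ?_
    have := h3 k hk
    have e2 : i + 1 + 1 + k = (i + 1 + k) + 1 := by omega
    rwa [e2] at this

theorem exists_prefixValue_eq (g : ℕ) {S : Set ℕ} (l : List S) (k : ℕ) :
    ∃ x ∈ sGapShift S, x k = 1 ∧ (∀ i < k, x i = 0) ∧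
      prefixValue g x (k + gapLength l + 1) = g ^ k * (1 + gapValue g l) := by
  induction l generalizing k with
  | nil =>
    induction k with
    | zero =>
      refine ⟨consSeq 1 fun _ => 0, consSeq_mem_sGapShift (fun i n h => by simp at h) (by simp),
        rfl, by simp, ?_⟩
      simp [prefixValue, consSeq, gapValue]
    | succ k ih =>
      obtain ⟨x, hx, h1, h2, h3⟩ := ih
      refine ⟨consSeq 0 x, consSeq_mem_sGapShift hx (by simp), h1, fun i hi => ?_, ?_⟩
      · cases i with
        | zero => rfl
        | succ i => exact h2 i (by omega)
      · have e : k + 1 + gapLength ([] : List S) + 1 = (k + gapLength ([] : List S) + 1) + 1 := by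
          omega
        rw [e, prefixValue, show shift (consSeq 0 x) = x from rfl, h3]
        simp [consSeq]; ring
  | cons s l ihl =>
    induction k with
    | zero =>
      obtain ⟨x, hx, h1, h2, h3⟩ := ihl s
      refine ⟨consSeq 1 x, consSeq_mem_sGapShift hx fun _ n hn hn' => ?_, rfl, by simp, ?_⟩
      · rcases lt_trichotomy n s with h | rfl | h
        · simp [h2 n h] at hn
        · exact s.2
        · simp [hn' s h] at h1
      · have e : 0 + gapLength (s :: l) + 1 = (s + gapLength l + 1) + 1 := by
          rw [gapLength_cons]; omega
        rw [e, prefixValue, show shift (consSeq 1 x) = x from rfl, h3, gapValue]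
        simp [consSeq]; ring
    | succ k ih =>
      obtain ⟨x, hx, h1, h2, h3⟩ := ih
      refine ⟨consSeq 0 x, consSeq_mem_sGapShift hx (by simp), h1, fun i hi => ?_, ?_⟩
      · cases i with
        | zero => rfl
        | succ i => exact h2 i (by omega)
      · have e : k + 1 + gapLength (s :: l) + 1 = (k + gapLength (s :: l) + 1) + 1 := by
          omega
        rw [e, prefixValue, show shift (consSeq 0 x) = x from rfl, h3]
        simp [consSeq]; ring

theorem pow_mul_mem_languageSet (g : ℕ) {S : Set ℕ} (k : ℕ) (l : List S) :
    g ^ k * (1 + gapValue g l) ∈ languageSet g (sGapShift S) := by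
  obtain ⟨x, hx, -, -, h⟩ := exists_prefixValue_eq g l k
  exact mem_languageSet_iff.2 ⟨x, hx, _, h.symm⟩

theorem zero_mem_languageSet (g : ℕ) (S : Set ℕ) : 0 ∈ languageSet g (sGapShift S) :=
  mem_languageSet_iff.2 ⟨fun _ => 0, fun i n h => by simp at h, 0, rfl⟩

theorem eq_zero_or_of_mem_languageSet {g : ℕ} {S : Set ℕ} {m : ℕ}
    (hm : m ∈ languageSet g (sGapShift S)) :
    m = 0 ∨ ∃ (k : ℕ) (l : List S), m = g ^ k * (1 + gapValue g l) := by
  obtain ⟨x, hx, n, rfl⟩ := mem_languageSet_iff.1 hm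
  exact (prefixValue_eq_zero_or hx n).imp id fun ⟨k, l, h, _⟩ => ⟨k, l, h⟩

theorem pow_add_gapLength_le (g : ℕ) {S : Set ℕ} (k : ℕ) (l : List S) :
    g ^ (k + gapLength l) ≤ g ^ k * (1 + gapValue g l) := by
  rw [pow_add]
  gcongr
  induction l with
  | nil => simp
  | cons s l ih => rw [gapLength_cons, gapValue, pow_add]; nlinarith [Nat.zero_le (g ^ ((s : ℕ) + 1))]

/-! ### Counting below powers of g and mass dimension -/

/-- The number of elements of `A` below `g ^ n`. -/
noncomputable def powCount (g : ℕ) (A : Set ℕ) (n : ℕ) : ℕ := (A ∩ Set.Iio (g ^ n)).ncard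

theorem ncard_inter_Iio_mono (A : Set ℕ) {m n : ℕ} (h : m ≤ n) :
    (A ∩ Set.Iio m).ncard ≤ (A ∩ Set.Iio n).ncard :=
  Set.ncard_le_ncard (Set.inter_subset_inter_right _ (Set.Iio_subset_Iio h))
    ((Set.finite_Iio n).inter_of_right A)

theorem hasMassDim_of_tendsto {A : Set ℕ} {d : ℝ} (h : Tendsto (massRatio A) atTop (𝓝 d)) :
    HasMassDim A d :=
  ⟨h.liminf_eq, h.limsup_eq⟩

theorem hasMassDim_zero_of_finite {A : Set ℕ} (hA : A.Finite) : HasMassDim A 0 := by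
  refine hasMassDim_of_tendsto ?_
  have hlog : Tendsto (fun N : ℕ => Real.log A.ncard / Real.log N) atTop (𝓝 0) :=
    tendsto_const_nhds.div_atTop (Real.tendsto_log_atTop.comp tendsto_natCast_atTop_atTop)
  refine squeeze_zero (fun N => (massRatio_mem_Icc A N).1) (fun N => ?_) hlog
  refine div_le_div_of_nonneg_right ?_ (Real.log_natCast_nonneg _)
  rcases Nat.eq_zero_or_pos (A ∩ Set.Iio N).ncard with h | h
  · simp [h, Real.log_natCast_nonneg]
  · exact Real.log_le_log (by exact_mod_cast h)
      (by exact_mod_cast Set.ncard_le_ncard Set.inter_subset_left hA)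

/-- The case m = 0 is covered by the convention `Real.log 0 = 0`. -/
theorem log_natCast_mono {m n : ℕ} (h : m ≤ n) : Real.log m ≤ Real.log n := by
  rcases Nat.eq_zero_or_pos m with rfl | hm
  · simpa using Real.log_natCast_nonneg n
  · exact Real.log_le_log (by exact_mod_cast hm) (by exact_mod_cast h)

theorem tendsto_div_add_nat {u : ℕ → ℝ} {h : ℝ}
    (hu : Tendsto (fun n : ℕ => u n / n) atTop (𝓝 h)) (c : ℝ) :
    Tendsto (fun n : ℕ => u n / (n + c)) atTop (𝓝 h) := by
  have h1 : Tendsto (fun n : ℕ => (n : ℝ) / (n + c)) atTop (𝓝 1) :=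
    tendsto_natCast_div_add_atTop c
  have h2 := hu.mul h1
  rw [mul_one] at h2
  refine h2.congr' ?_
  filter_upwards [eventually_gt_atTop 0] with n hn
  have : (n : ℝ) ≠ 0 := by positivity
  field_simp

/-- N lies between consecutive powers of g, and a shift of the exponent by 1 is lost in the limit.
-/
theorem tendsto_massRatio {g : ℕ} (hg : 2 ≤ g) {A : Set ℕ} {h : ℝ}
    (hA : Tendsto (fun n : ℕ => Real.log (powCount g A n) / n) atTop (𝓝 h)) :
    Tendsto (massRatio A) atTop (𝓝 (h / Real.log g)) := by
  have hlg : 0 < Real.log g := Real.log_pos (by exact_mod_cast hg)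
  have hcomp : Tendsto (Nat.log g) atTop atTop :=
    tendsto_atTop_atTop.2 fun n => ⟨g ^ n, fun N hN => Nat.le_log_of_pow_le hg hN⟩
  have hlow : Tendsto (fun n : ℕ => Real.log (powCount g A n) / (n + 1) / Real.log g) atTop
      (𝓝 (h / Real.log g)) := (tendsto_div_add_nat hA 1).div_const _
  have hup : Tendsto (fun n : ℕ => Real.log (powCount g A (n + 1)) / n / Real.log g) atTop
      (𝓝 (h / Real.log g)) := by
    refine Tendsto.div_const ?_ _
    have h1 := tendsto_div_add_nat hA (-1)
    refine (h1.comp (tendsto_add_atTop_nat 1)).congr fun n => ?_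
    simp
  refine tendsto_of_tendsto_of_tendsto_of_le_of_le' (hlow.comp hcomp) (hup.comp hcomp) ?_ ?_
  · filter_upwards [eventually_ge_atTop g] with N hN
    have hN0 : N ≠ 0 := by omega
    have h1 : powCount g A (Nat.log g N) ≤ (A ∩ Set.Iio N).ncard :=
      ncard_inter_Iio_mono A (Nat.pow_log_le_self g hN0)
    have h2 : Real.log N ≤ (Nat.log g N + 1) * Real.log g := by
      have := log_natCast_mono (Nat.lt_pow_succ_log_self hg N).le
      rw [Nat.cast_pow, Real.log_pow] at this
      exact_mod_cast this
    have h3 : 0 < Real.log N := Real.log_pos (by exact_mod_cast (by omega : 1 < N))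
    simp only [Function.comp_apply, massRatio, div_div]
    exact div_le_div₀ (Real.log_natCast_nonneg _) (log_natCast_mono h1) h3 h2
  · filter_upwards [eventually_ge_atTop g] with N hN
    have hN0 : N ≠ 0 := by omega
    have h1 : (A ∩ Set.Iio N).ncard ≤ powCount g A (Nat.log g N + 1) :=
      ncard_inter_Iio_mono A (Nat.lt_pow_succ_log_self hg N).le
    have h2 : Nat.log g N * Real.log g ≤ Real.log N := by
      have := log_natCast_mono (Nat.pow_log_le_self g hN0)
      rwa [Nat.cast_pow, Real.log_pow] at this
    have h3 : 0 < Nat.log g N := Nat.log_pos hg hN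
    simp only [Function.comp_apply, massRatio, div_div]
    exact div_le_div₀ (Real.log_natCast_nonneg _) (log_natCast_mono h1) (by positivity) h2

theorem exists_tendsto_log_powCount {g : ℕ} (hg : 2 ≤ g) (S : Set ℕ) :
    ∃ h : ℝ, Tendsto (fun n : ℕ =>
      Real.log (powCount g (languageSet g (sGapShift S)) n) / n) atTop (𝓝 h) := by
  set A := languageSet g (sGapShift S) with hA
  have hpos : ∀ n, 0 < powCount g A n := fun n => by
    rw [powCount, Set.ncard_pos ((Set.finite_Iio _).inter_of_right A)]
    exact ⟨0, zero_mem_languageSet g S, show 0 < g ^ n by positivity⟩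
  -- A number is determined by its lowest m digits and the rest, and both parts stay in A.
  have hsub : ∀ m n, powCount g A (m + n) ≤ powCount g A m * powCount g A n := fun m n => by
    rw [powCount, powCount, powCount, ← Set.ncard_prod]
    refine Set.ncard_le_ncard_of_injOn (fun x => (x % g ^ m, x / g ^ m)) ?_ ?_
      (((Set.finite_Iio _).inter_of_right A).prod ((Set.finite_Iio _).inter_of_right A))
    · rintro x ⟨hx, hlt⟩
      refine ⟨⟨mod_pow_mem_languageSet hg hx m, Nat.mod_lt _ (by positivity)⟩,
        div_pow_mem_languageSet hg hx m, ?_⟩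
      rw [Set.mem_Iio, pow_add] at hlt
      exact Nat.div_lt_of_lt_mul hlt
    · intro x _ y _ hxy
      simp only [Prod.mk.injEq] at hxy
      rw [← Nat.mod_add_div x (g ^ m), ← Nat.mod_add_div y (g ^ m), hxy.1, hxy.2]
  have hs : Subadditive fun n => Real.log (powCount g A n) := fun m n => by
    have h1 := hpos m
    have h2 := hpos n
    rw [← Real.log_mul (by positivity) (by positivity), ← Nat.cast_mul]
    exact log_natCast_mono (hsub m n)
  refine ⟨_, hs.tendsto_lim ⟨0, ?_⟩⟩
  rintro _ ⟨n, rfl⟩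
  exact div_nonneg (Real.log_natCast_nonneg _) (Nat.cast_nonneg n)

/-- The number of lists of gaps of length at most `n`. -/
noncomputable def gapCount (S : Set ℕ) (n : ℕ) : ℕ := {l : List S | gapLength l ≤ n}.ncard

theorem gapCount_pos (S : Set ℕ) (n : ℕ) : 0 < gapCount S n := by
  rw [gapCount, Set.ncard_pos (finite_gapLength_le S n)]
  exact ⟨[], by simp⟩

/-- Below g^n there are at most n choices of k for each list; the extra 1 in n + 1 pays for the
element 0. -/
theorem powCount_le_mul_gapCount {g : ℕ} (hg : 2 ≤ g) (S : Set ℕ) (n : ℕ) :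
    powCount g (languageSet g (sGapShift S)) n ≤ (n + 1) * gapCount S n := by
  have hfin := finite_gapLength_le S n
  have hsub : languageSet g (sGapShift S) ∩ Set.Iio (g ^ n) ⊆
      insert 0 ((fun q : ℕ × List S => g ^ q.1 * (1 + gapValue g q.2)) ''
        (Set.Iio n ×ˢ {l : List S | gapLength l ≤ n})) := by
    rintro m ⟨hm, hlt⟩
    rcases eq_zero_or_of_mem_languageSet hm with rfl | ⟨k, l, rfl⟩
    · exact Set.mem_insert _ _
    · have h1 := (Nat.pow_lt_pow_iff_right hg).1 ((pow_add_gapLength_le g k l).trans_lt hlt)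
      exact Set.mem_insert_of_mem _ ⟨(k, l), ⟨by simp; omega, by simp; omega⟩, rfl⟩
  have hfin' := (Set.finite_Iio n).prod hfin
  have h1 := Set.ncard_le_ncard hsub ((hfin'.image _).insert 0)
  have h2 := Set.ncard_image_le (f := fun q : ℕ × List S => g ^ q.1 * (1 + gapValue g q.2)) hfin'
  rw [Set.ncard_prod] at h2
  have h3 : (Set.Iio n).ncard = n := by simp [Set.ncard_eq_toFinset_card']
  rw [h3] at h2
  have h4 := (Set.ncard_insert_le 0 ((fun q : ℕ × List S => g ^ q.1 * (1 + gapValue g q.2)) ''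
        (Set.Iio n ×ˢ {l : List S | gapLength l ≤ n})))
  have h5 := gapCount_pos S n
  rw [← gapCount] at h2
  rw [powCount]
  linarith

/-! ### Intersections with arithmetic progressions -/

/-- Strip gcd(g, a) from a repeatedly until the remaining factor is coprime to g. -/
theorem exists_eq_mul_dvd_pow_coprime (g : ℕ) {a : ℕ} (ha : 0 < a) :
    ∃ a₁ a₂ q, a = a₁ * a₂ ∧ a₁ ∣ g ^ q ∧ Nat.Coprime g a₂ := by
  induction a using Nat.strong_induction_on with
  | _ a ih =>
    by_cases hc : Nat.Coprime g a
    · exact ⟨1, a, 0, by simp, by simp, hc⟩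
    · obtain ⟨b, hb⟩ := Nat.gcd_dvd_right g a
      have hd : 1 < Nat.gcd g a := by
        have := Nat.gcd_pos_of_pos_right g ha
        have : Nat.gcd g a ≠ 1 := hc
        omega
      have hb0 : 0 < b := Nat.pos_of_ne_zero fun h => by simp [h] at hb; omega
      obtain ⟨a₁, a₂, q, h1, h2, h3⟩ := ih b (by rw [hb]; nlinarith) hb0
      refine ⟨Nat.gcd g a * a₁, a₂, q + 1, by rw [mul_assoc, ← h1]; exact hb, ?_, h3⟩
      rw [pow_succ']
      exact mul_dvd_mul (Nat.gcd_dvd_left g a) h2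

/-- The permutation `y ↦ g ^ (s₁ + 1) (1 + g ^ (s₂ + 1) (1 + ⋯ (1 + y)))` of the integers modulo
`a` that belongs to a list of gaps. -/
def gapPerm {g a : ℕ} (h : Nat.Coprime g a) {S : Set ℕ} (l : List S) : Equiv.Perm (ZMod a) :=
  (l.map fun s : S =>
    Units.mulLeft (ZMod.unitOfCoprime g h ^ ((s : ℕ) + 1)) * Equiv.addLeft 1).prod

theorem gapPerm_append {g a : ℕ} (h : Nat.Coprime g a) {S : Set ℕ} (l l' : List S) :
    gapPerm h (l ++ l') = gapPerm h l * gapPerm h l' := by simp [gapPerm]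

theorem gapPerm_zero {g a : ℕ} (h : Nat.Coprime g a) {S : Set ℕ} (l : List S) :
    gapPerm h l 0 = (gapValue g l : ZMod a) := by
  induction l with
  | nil => simp [gapPerm, gapValue]
  | cons s l ih =>
    have e : gapPerm h (s :: l) = Units.mulLeft (ZMod.unitOfCoprime g h ^ ((s : ℕ) + 1)) *
      Equiv.addLeft 1 * gapPerm h l := by simp [gapPerm]
    rw [e, Equiv.Perm.mul_apply, ih, gapValue]
    simp

theorem exists_gapPerm_eq_pow {g a : ℕ} (h : Nat.Coprime g a) {S : Set ℕ} (l : List S) (n : ℕ) :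
    ∃ l' : List S, gapPerm h l' = gapPerm h l ^ n := by
  induction n with
  | zero => exact ⟨[], by simp [gapPerm]⟩
  | succ n ih =>
    obtain ⟨l', hl'⟩ := ih
    exact ⟨l' ++ l, by rw [gapPerm_append, hl', pow_succ]⟩

/-- Every list of gaps can be completed to one with trivial permutation, the completion depending
only on the permutation of the list. -/
theorem exists_completion {g a : ℕ} [NeZero a] (h : Nat.Coprime g a) (S : Set ℕ) :
    ∃ v : Equiv.Perm (ZMod a) → List S, ∀ l : List S,
      gapPerm h (l ++ v (gapPerm h l)) = 1 := by
  have key : ∀ σ : Equiv.Perm (ZMod a), ∃ v : List S, ∀ l : List S,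
      gapPerm h l = σ → gapPerm h (l ++ v) = 1 := by
    intro σ
    by_cases hσ : ∃ l : List S, gapPerm h l = σ
    · obtain ⟨l, rfl⟩ := hσ
      -- In a finite group the inverse is a nonnegative power, so repeating `l` realizes it.
      obtain ⟨v, hv⟩ := exists_gapPerm_eq_pow h l (orderOf (gapPerm h l) - 1)
      refine ⟨v, fun l' hl' => ?_⟩
      rw [gapPerm_append, hl', hv, ← pow_succ', Nat.sub_add_cancel (orderOf_pos _),
        pow_orderOf_eq_one]
    · exact ⟨[], fun l hl => (hσ ⟨l, hl⟩).elim⟩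
  choose v hv using key
  exact ⟨v, fun l => hv _ l rfl⟩

/-- Send l to l₀ ++ l ++ v, with l₀ from a fixed element of the intersection and v the completion of
l. Since v depends only on the permutation of l, recording that permutation makes the map injective;
Q counts the permutations. -/
theorem exists_gapCount_le {g : ℕ} (hg : 2 ≤ g) (S : Set ℕ) {a b : ℕ} (ha : 0 < a)
    (hinf : (languageSet g (sGapShift S) ∩ arithProg a b).Infinite) :
    ∃ K Q : ℕ, ∀ n, gapCount S n ≤
      Q * powCount g (languageSet g (sGapShift S) ∩ arithProg a b) (n + K) := by
  obtain ⟨a₁, a₂, q, rfl, hq, hcop⟩ := exists_eq_mul_dvd_pow_coprime g ha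
  have : NeZero a₂ := ⟨fun h => by simp [h] at ha⟩
  -- Exceeding g^q forces q ≤ k + `gapLength l₀`, so that a₁ divides the weight of everything
  -- appended after l₀.
  obtain ⟨m, ⟨hmA, c, hc⟩, hmq⟩ := hinf.exists_gt (g ^ q)
  rcases eq_zero_or_of_mem_languageSet hmA with rfl | ⟨k, l₀, rfl⟩
  · simp at hmq
  have hlt : g ^ q < g ^ (k + gapLength l₀ + 1) := by
    refine hmq.trans ?_
    rw [add_assoc, pow_add]
    exact Nat.mul_lt_mul_of_pos_left (one_add_gapValue_lt hg l₀) (by positivity)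
  have hqle : q ≤ k + gapLength l₀ := by
    have := (Nat.pow_lt_pow_iff_right hg).1 hlt
    omega
  have hdvd : a₁ ∣ g ^ (k + gapLength l₀) := hq.trans (pow_dvd_pow g hqle)
  obtain ⟨v, hv⟩ := exists_completion hcop S
  have hvdvd : ∀ l : List S, a₂ ∣ gapValue g (l ++ v (gapPerm hcop l)) := fun l => by
    have := gapPerm_zero hcop (l ++ v (gapPerm hcop l))
    rw [hv, Equiv.Perm.one_apply] at this
    exact (ZMod.natCast_eq_zero_iff _ _).1 this.symm
  set C := Finset.univ.sup fun σ => gapLength (v σ) with hC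
  have hCle : ∀ σ, gapLength (v σ) ≤ C := fun σ =>
    Finset.le_sup (f := fun σ => gapLength (v σ)) (Finset.mem_univ σ)
  refine ⟨k + gapLength l₀ + C + 1, Nat.card (Equiv.Perm (ZMod a₂)), fun n => ?_⟩
  rw [powCount, ← Set.ncard_univ, ← Set.ncard_prod, gapCount]
  refine Set.ncard_le_ncard_of_injOn (fun l => (gapPerm hcop l,
    g ^ k * (1 + gapValue g (l₀ ++ (l ++ v (gapPerm hcop l)))))) (fun l hl => ?_) ?_
    (Set.finite_univ.prod ((Set.finite_Iio _).inter_of_right _))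
  · refine ⟨Set.mem_univ _, ⟨pow_mul_mem_languageSet g k _, ?_⟩, ?_⟩
    · obtain ⟨y, hy⟩ := mul_dvd_mul hdvd (hvdvd l)
      -- Appending only adds the multiple a₁ a₂ y to the fixed element, so the result stays in the
      -- progression and does not fall below b.
      refine ⟨c + y, ?_⟩
      calc g ^ k * (1 + gapValue g (l₀ ++ (l ++ v (gapPerm hcop l))))
          = g ^ k * (1 + gapValue g l₀) +
            g ^ (k + gapLength l₀) * gapValue g (l ++ v (gapPerm hcop l)) := by
            rw [gapValue_append, pow_add]; ring
        _ = a₁ * a₂ * (c + y) + b := by rw [hy, hc]; ring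
    · have h1 := one_add_gapValue_lt hg (l₀ ++ (l ++ v (gapPerm hcop l)))
      have h2 := hCle (gapPerm hcop l)
      have h3 : gapLength l ≤ n := hl
      rw [gapLength_append, gapLength_append] at h1
      calc g ^ k * (1 + gapValue g (l₀ ++ (l ++ v (gapPerm hcop l))))
          < g ^ k * g ^ (gapLength l₀ + (gapLength l + gapLength (v (gapPerm hcop l))) + 1) :=
            Nat.mul_lt_mul_of_pos_left h1 (by positivity)
        _ ≤ g ^ (n + (k + gapLength l₀ + C + 1)) := by
            rw [← pow_add]
            exact Nat.pow_le_pow_right (by omega) (by omega)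
  · intro l _ l' _ hll
    simp only [Prod.mk.injEq] at hll
    obtain ⟨h1, h2⟩ := hll
    have h3 := Nat.eq_of_mul_eq_mul_left (by positivity) h2
    have h4 := gapValue_injective hg (Nat.add_left_cancel h3)
    rw [h1] at h4
    exact List.append_cancel_right (List.append_cancel_left h4)

theorem tendsto_log_powCount_inter_arithProg {g : ℕ} (hg : 2 ≤ g) (S : Set ℕ) {a b : ℕ}
    (ha : 0 < a) (hinf : (languageSet g (sGapShift S) ∩ arithProg a b).Infinite) {h : ℝ}
    (hA : Tendsto (fun n : ℕ =>
      Real.log (powCount g (languageSet g (sGapShift S)) n) / n) atTop (𝓝 h)) :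
    Tendsto (fun n : ℕ => Real.log (powCount g
      (languageSet g (sGapShift S) ∩ arithProg a b) n) / n) atTop (𝓝 h) := by
  obtain ⟨K, Q, hK⟩ := exists_gapCount_le hg S ha hinf
  set A := languageSet g (sGapShift S)
  set B := A ∩ arithProg a b
  have hle : ∀ n, Real.log (powCount g A n) - Real.log (n + 1) - Real.log Q ≤
      Real.log (powCount g B (n + K)) := fun n => by
    have h1 := gapCount_pos S n
    have h2 := hK n
    have h3 : 0 < Q * powCount g B (n + K) := h1.trans_le h2
    have hQ : 0 < Q := Nat.pos_of_mul_pos_right h3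
    have hB : 0 < powCount g B (n + K) := Nat.pos_of_mul_pos_left h3
    have h4 := log_natCast_mono ((powCount_le_mul_gapCount hg S n).trans
      (Nat.mul_le_mul_left (n + 1) h2))
    push_cast at h4
    rw [Real.log_mul (by positivity) (by positivity),
      Real.log_mul (by positivity) (by positivity)] at h4
    linarith
  have hlog : Tendsto (fun n : ℕ => Real.log (n + 1) / n) atTop (𝓝 0) := by
    have h1 : Tendsto (fun n : ℕ => Real.log n / n) atTop (𝓝 0) := by
      have := (Real.isLittleO_log_id_atTop.tendsto_div_nhds_zero).comp
        (tendsto_natCast_atTop_atTop (R := ℝ))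
      exact this
    have h2 := (tendsto_div_add_nat h1 (-1)).comp (tendsto_add_atTop_nat 1)
    refine h2.congr fun n => ?_
    simp
  have hlow : Tendsto (fun n : ℕ =>
      (Real.log (powCount g A n) - Real.log (n + 1) - Real.log Q) / n) atTop (𝓝 h) := by
    have h1 := (hA.sub hlog).sub
      (tendsto_const_div_atTop_nhds_zero_nat (Real.log Q))
    simp only [sub_zero] at h1
    exact h1.congr fun n => by ring
  have hlow' := tendsto_div_add_nat hlow K
  rw [← tendsto_add_atTop_iff_nat K]
  rw [← tendsto_add_atTop_iff_nat K] at hA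
  refine tendsto_of_tendsto_of_tendsto_of_le_of_le hlow' hA (fun n => ?_) fun n => ?_
  · push_cast
    exact div_le_div_of_nonneg_right (hle n) (by positivity)
  · refine div_le_div_of_nonneg_right (log_natCast_mono ?_) (by positivity)
    exact Set.ncard_le_ncard (Set.inter_subset_inter_left _ Set.inter_subset_left)
      ((Set.finite_Iio _).inter_of_right A)

end GapShift

theorem mainTheorem9 :
    (∀ (g : ℕ) (_ : 2 ≤ g) (S : Set ℕ),
      ∃ d : ℝ, GapShift.HasMassDim (GapShift.languageSet g (GapShift.sGapShift S)) d ∧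
        ∀ (a b : ℕ) (_ : 0 < a),
          GapShift.HasMassDim
              (GapShift.languageSet g (GapShift.sGapShift S) ∩ GapShift.arithProg a b) 0 ∨
            GapShift.HasMassDim
              (GapShift.languageSet g (GapShift.sGapShift S) ∩ GapShift.arithProg a b) d) ∧
    (GapShift.IsSubshift (GapShift.sGapShift {p : ℕ | p.Prime}) ∧
      ¬ GapShift.IsSofic (GapShift.sGapShift {p : ℕ | p.Prime})) := by
  refine ⟨fun g hg S => ?_, GapShift.isSubshift_sGapShift _,
    GapShift.not_isSofic_sGapShift_primes⟩
  obtain ⟨h, hh⟩ := GapShift.exists_tendsto_log_powCount hg S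
  refine ⟨h / Real.log g, GapShift.hasMassDim_of_tendsto (GapShift.tendsto_massRatio hg hh),
    fun a b ha => ?_⟩
  rcases Set.finite_or_infinite
    (GapShift.languageSet g (GapShift.sGapShift S) ∩ GapShift.arithProg a b) with hfin | hinf
  · exact Or.inl (GapShift.hasMassDim_zero_of_finite hfin)
  · exact Or.inr (GapShift.hasMassDim_of_tendsto (GapShift.tendsto_massRatio hg
      (GapShift.tendsto_log_powCount_inter_arithProg hg S ha hinf hh)))
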